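/- \textbf{Events and traces.} An event is $e=\langle t,op\rangle$ (with a unique id), where $t$ is the thread performing it and $op$ is one of $\mathtt r(x)$, $\mathtt w(x)$ (read/write of a memory location $x$), $\mathtt{acq}(\ell)$, $\mathtt{rel}(\ell)$ (acquire/release of a lock $\ell$), $\mathtt{fork}(u)$, $\mathtt{join}(u)$ (for a thread $u$). It is an \emph{event of thread} $s$ if $s=t$ or $op\in\{\mathtt{fork}(s),\mathtt{join}(s)\}$. A \emph{trace} $\sigma$ is a finite sequence of distinct events such that: for every lock $\ell$ the subsequence $\sigma|_\ell$ of acquires and releases of $\ell$ is a prefix of a word of $(\bigcup_t \langle t,\mathtt{acq}(\ell)\rangle\langle t,\mathtt{rel}(\ell)\rangle)^*$; no event of a thread $u$ occurs before a $\mathtt{fork}(u)$; and no event of $u$ occurs after a $\mathtt{join}(u)$, except for repetitions of $\mathtt{join}(u)$ by the same joining thread. Let $\sigma|_t$ be the subsequence of events of thread $t$, and let $e\le_{tr}^\sigma e'$ mean that $e=e'$ or $e$ appears before $e'$ in $\sigma$. The last write $\mathrm{lw}_\sigma(e)$ of a read $e$ of $x$ is the last $\mathtt w(x)$-event before $e$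 in $\sigma$ (possibly undefined). \textbf{Happens-before.} $\le_{HB}^\sigma$ is the smallest partial order on the events of $\sigma$ such that $e\le_{HB}^\sigma e'$ whenever $e\le_{tr}^\sigma e'$ and either $e,e'$ are events of a common thread, or $e=\langle t,\mathtt{rel}(\ell)\rangle$ and $e'=\langle t',\mathtt{acq}(\ell)\rangle$ for some lock $\ell$. \textbf{Reorderings and races.} A trace $\sigma'$ is a \emph{correct reordering} of $\sigma$ if $\sigma'|_t$ is a prefix of $\sigma|_t$ for every thread $t$ and, for every read $e=\langle t,\mathtt r(x)\rangle$ in $\sigma'$ that is not the last event of $\sigma'|_t$, $\mathrm{lw}_{\sigma'}(e)$ is defined iff $\mathrm{lw}_\sigma(e)$ is, and then they are equal. It \emph{respects} $\le_{HB}^\sigma$ if $e\le_{HB}^\sigma e'$ and $e'\in\sigma'$ imply $e\in\sigma'$ and $e\le_{tr}^{\sigma'}e'$. Two reads/writes of the same location are \emph{conflicting} if they are performed by different threads and at least one is a write. For conflicting events $e\le_{tr}^\sigma e'$ of $\sigma$, the pair $(e,e')$ is an \emph{$HB_\sigma$-schedulable race} if there is a correct reordering $\sigma'$ of $\sigma$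 that respects $\le_{HB}^\sigma$ with $\sigma'=\sigma''ee'$ or $\sigma'=\sigma''e'e$ for some trace $\sigma''$. \textbf{Algorithm 1.} Vector times are maps from threads to $\mathbb N$, with pointwise order $\sqsubseteq$, pointwise maximum $\sqcup$, bottom $\bot=0$, and update $V[n/t]$. The state consists of vector clocks $\mathbb C_t$ (threads $t$), $\mathbb L_\ell$ (locks $\ell$), $\mathbb{LW}_x,\mathbb R_x,\mathbb W_x$ (locations $x$), initially $\mathbb C_t=\bot[1/t]$ and all others $\bot$. The events are processed in trace order; the handler of an event performed by $t$ is: \begin{itemize} \item $\mathtt{acq}(\ell)$: $\mathbb C_t:=\mathbb C_t\sqcup\mathbb L_\ell$. \item $\mathtt{rel}(\ell)$: $\mathbb L_\ell:=\mathbb C_t$; then $\mathbb C_t(t):=\mathbb C_t(t)+1$. \item $\mathtt{fork}(u)$: $\mathbb C_u:=\mathbb C_t[1/u]$; then $\mathbb C_t(t):=\mathbb C_t(t)+1$. \item $\mathtt{join}(u)$: $\mathbb C_t:=\mathbb C_t\sqcup\mathbb C_u$. \item $\mathtt r(x)$: if $\neg(\mathbb W_x\sqsubseteq\mathbb C_t)$,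 declare a race; then $\mathbb C_t:=\mathbb C_t\sqcup\mathbb{LW}_x$; then $\mathbb R_x(t):=\mathbb C_t(t)$. \item $\mathtt w(x)$: if $\neg(\mathbb R_x\sqsubseteq\mathbb C_t)$, declare a race; if $\neg(\mathbb W_x\sqsubseteq\mathbb C_t)$, declare a race; then $\mathbb{LW}_x:=\mathbb C_t$; $\mathbb W_x(t):=\mathbb C_t(t)$; $\mathbb C_t(t):=\mathbb C_t(t)+1$. \end{itemize} The algorithm \emph{reports a race at} $e$ if it declares a race while processing $e$. \textbf{Theorem.} Let $\sigma$ be a trace and $e$ a read or write event of $\sigma$. Algorithm 1, run on $\sigma$, reports a race at $e$ if and only if there is an event $e'$ of $\sigma$ such that $(e',e)$ is an $HB_\sigma$-schedulable race. -/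

import Mathlib

namespace SHB

/-- The operations of a concurrent program, over threads `T`, locks `L` and memory locations `V`. -/
inductive Op (T L V : Type*) where
  | read (x : V)
  | write (x : V)
  | acq (l : L)
  | rel (l : L)
  | fork (u : T)
  | join (u : T)
  deriving DecidableEq

/-- An event: an operation performed by a thread, tagged with an event id (so that two occurrences
of a thread performing the same operation are different events). -/
structure Event (T L V : Type*) where
  uid : ℕ
  tid : T
  op : Op T L V
  deriving DecidableEq

variable {T L V : Type*} [DecidableEq T] [DecidableEq L] [DecidableEq V]

/-! ### Traces -/

/-- `e` is an event of thread `t`: it is performed by `t`, or it forks or joins `t`. -/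
def Event.OfThread (e : Event T L V) (t : T) : Prop :=
  e.tid = t ∨ e.op = Op.fork t ∨ e.op = Op.join t

instance (e : Event T L V) (t : T) : Decidable (e.OfThread t) :=
  inferInstanceAs (Decidable (_ ∨ _ ∨ _))

/-- `e` acquires or releases the lock `l`. -/
def Event.OfLock (e : Event T L V) (l : L) : Prop :=
  e.op = Op.acq l ∨ e.op = Op.rel l

instance (e : Event T L V) (l : L) : Decidable (e.OfLock l) :=
  inferInstanceAs (Decidable (_ ∨ _))

/-- The projection of `σ` to the thread `t`. -/
def threadProj (σ : List (Event T L V)) (t : T) : List (Event T L V) :=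
  σ.filter (fun e => decide (e.OfThread t))

/-- The projection of `σ` to the lock `l`. -/
def lockProj (σ : List (Event T L V)) (l : L) : List (Event T L V) :=
  σ.filter (fun e => decide (e.OfLock l))

/-- `e` appears (strictly) before `e'` in the sequence `σ`. -/
def Before (σ : List (Event T L V)) (e e' : Event T L V) : Prop :=
  List.Sublist [e, e'] σ

/-- Traces: finite sequences of events with distinct ids that are well formed. -/
structure IsTrace (σ : List (Event T L V)) : Prop where
  /-- Events have unique ids. -/
  uid_nodup : (σ.map Event.uid).Nodup
  /-- For each lock `l`, the projection to `l` is a prefix of a word of the regular language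
  `(⋃ t, ⟨t, acq l⟩ ⟨t, rel l⟩)^*`; `ts` lists the threads of the successive blocks. -/
  locks : ∀ l : L, ∃ ts : List T,
    ((lockProj σ l).map (fun e => (e.tid, e.op))) <+:
      ts.flatMap (fun t => [(t, Op.acq l), (t, Op.rel l)])
  /-- No event of a thread appears before a fork of that thread. -/
  fork_first : ∀ (u : T) (e f : Event T L V), Before σ e f → f.op = Op.fork u → ¬ e.OfThread u
  /-- No event of a thread appears after a join of that thread, except that the joining thread
  may repeat the join. -/
  join_last : ∀ (u : T) (j e : Event T L V), Before σ j e → j.op = Op.join u → e.OfThread u →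
    e.op = Op.join u ∧ e.tid = j.tid

/-- `w` is the last write before the read event `e` in `σ`. -/
def IsLastWrite (σ : List (Event T L V)) (w e : Event T L V) : Prop :=
  ∃ x : V, e.op = Op.read x ∧ w.op = Op.write x ∧ Before σ w e ∧
    ∀ w' : Event T L V, w'.op = Op.write x → ¬ (Before σ w w' ∧ Before σ w' e)

/-! ### Orders -/

/-- The trace order. -/
def TraceOrder (σ : List (Event T L V)) (e e' : Event T L V) : Prop :=
  e ∈ σ ∧ e' ∈ σ ∧ (e = e' ∨ Before σ e e')

/-- The thread order: the smallest partial order on the events of `σ` that contains all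
trace-ordered pairs of events of a common thread. (Such pairs include the pairs `(e, e)`.) -/
def ThreadOrder (σ : List (Event T L V)) : Event T L V → Event T L V → Prop :=
  Relation.TransGen (fun e e' =>
    TraceOrder σ e e' ∧ ∃ t : T, e.OfThread t ∧ e'.OfThread t)

/-- Happens-before: the smallest partial order on the events of `σ` that contains the thread order
and all trace-ordered pairs of a release and an acquire of a common lock. -/
def HappensBefore (σ : List (Event T L V)) : Event T L V → Event T L V → Prop :=
  Relation.TransGen (fun e e' =>
    ThreadOrder σ e e' ∨
      (TraceOrder σ e e' ∧ ∃ l : L, e.op = Op.rel l ∧ e'.op = Op.acq l))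

/-! ### Reorderings and races -/

/-- `σ'` is a correct reordering of `σ`. The second condition says that, for a read that is not the
last event of its thread in `σ'`, the last write is defined in `σ'` iff it is defined in `σ`,
and then it is the same event. -/
def CorrectReordering (σ σ' : List (Event T L V)) : Prop :=
  IsTrace σ' ∧
  (∀ t : T, threadProj σ' t <+: threadProj σ t) ∧
  (∀ (e : Event T L V) (x : V), e ∈ σ' → e.op = Op.read x →
    (threadProj σ' e.tid).getLast? ≠ some e →
    ∀ w : Event T L V, IsLastWrite σ' w e ↔ IsLastWrite σ w e)

/-- `σ'` respects the happens-before order of `σ`. -/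
def RespectsHB (σ σ' : List (Event T L V)) : Prop :=
  ∀ e e' : Event T L V, HappensBefore σ e e' → e' ∈ σ' → e ∈ σ' ∧ TraceOrder σ' e e'

/-- Two data accesses conflict: they access the same location, are performed by different threads,
and at least one of them is a write. -/
def Conflicting (e e' : Event T L V) : Prop :=
  e.tid ≠ e'.tid ∧ ∃ x : V,
    (e.op = Op.write x ∧ e'.op = Op.write x) ∨
    (e.op = Op.write x ∧ e'.op = Op.read x) ∨
    (e.op = Op.read x ∧ e'.op = Op.write x)

/-- `(e, e')` is an HB-schedulable race of `σ`. -/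
def HBSchedulableRace (σ : List (Event T L V)) (e e' : Event T L V) : Prop :=
  TraceOrder σ e e' ∧ Conflicting e e' ∧
  ∃ σ' : List (Event T L V), CorrectReordering σ σ' ∧ RespectsHB σ σ' ∧
    ∃ σ'' : List (Event T L V), IsTrace σ'' ∧ (σ' = σ'' ++ [e, e'] ∨ σ' = σ'' ++ [e', e])

/-! ### The vector clock algorithm -/

/-- Vector times. The comparison is the pointwise order `≤`, the join is the pointwise
maximum `⊔`, the update `V[n/t]` is `Function.update V t n`, and the bottom is `0`. -/
abbrev VTime (T : Type*) := T → ℕ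

/-- The state of the algorithm: the vector clocks `C t`, `Lk l`, `LW x`, `R x`, `W x`. -/
structure VCState (T L V : Type*) where
  C : T → VTime T
  Lk : L → VTime T
  LW : V → VTime T
  R : V → VTime T
  W : V → VTime T

/-- Procedure `Initialization`. -/
def VCState.initial : VCState T L V where
  C := fun t => Function.update 0 t 1
  Lk := fun _ => 0
  LW := fun _ => 0
  R := fun _ => 0
  W := fun _ => 0

/-- The assignment `C_t := c`. -/
def VCState.setC (s : VCState T L V) (t : T) (c : VTime T) : VCState T L V :=
  { s with C := Function.update s.C t c }

/-- The assignment `L_l := c`. -/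
def VCState.setLk (s : VCState T L V) (l : L) (c : VTime T) : VCState T L V :=
  { s with Lk := Function.update s.Lk l c }

/-- The assignment `LW_x := c`. -/
def VCState.setLW (s : VCState T L V) (x : V) (c : VTime T) : VCState T L V :=
  { s with LW := Function.update s.LW x c }

/-- The assignment `R_x(t) := C_t(t)`. -/
def VCState.recordRead (s : VCState T L V) (t : T) (x : V) : VCState T L V :=
  { s with R := Function.update s.R x (Function.update (s.R x) t (s.C t t)) }

/-- The assignment `W_x(t) := C_t(t)`. -/
def VCState.recordWrite (s : VCState T L V) (t : T) (x : V) : VCState T L V :=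
  { s with W := Function.update s.W x (Function.update (s.W x) t (s.C t t)) }

/-- The assignment `C_t(t) := C_t(t) + 1`. -/
def VCState.tick (s : VCState T L V) (t : T) : VCState T L V :=
  s.setC t (Function.update (s.C t) t (s.C t t + 1))

/-- Procedure `acquire(t, l)`. -/
def VCState.acquire (s : VCState T L V) (t : T) (l : L) : VCState T L V :=
  s.setC t (s.C t ⊔ s.Lk l)

/-- Procedure `release(t, l)`. -/
def VCState.release (s : VCState T L V) (t : T) (l : L) : VCState T L V :=
  (s.setLk l (s.C t)).tick t

/-- Procedure `fork(t, u)`. -/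
def VCState.fork (s : VCState T L V) (t u : T) : VCState T L V :=
  (s.setC u (Function.update (s.C t) u 1)).tick t

/-- Procedure `join(t, u)`. -/
def VCState.join (s : VCState T L V) (t u : T) : VCState T L V :=
  s.setC t (s.C t ⊔ s.C u)

/-- Procedure `read(t, x)`, the assignments after the race check. -/
def VCState.read (s : VCState T L V) (t : T) (x : V) : VCState T L V :=
  (s.setC t (s.C t ⊔ s.LW x)).recordRead t x

/-- Procedure `write(t, x)`, the assignments after the race checks. -/
def VCState.write (s : VCState T L V) (t : T) (x : V) : VCState T L V :=
  ((s.setLW x (s.C t)).recordWrite t x).tick t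

/-- The effect on the state of the handler of the event `e`. -/
def VCState.step (s : VCState T L V) (e : Event T L V) : VCState T L V :=
  match e.op with
  | Op.read x => s.read e.tid x
  | Op.write x => s.write e.tid x
  | Op.acq l => s.acquire e.tid l
  | Op.rel l => s.release e.tid l
  | Op.fork u => s.fork e.tid u
  | Op.join u => s.join e.tid u

/-- The handler of `e`, started in the state `s`, declares a race (with a read or with a write).
All the checks of a handler precede its assignments. -/
def VCState.DeclaresRace (s : VCState T L V) (e : Event T L V) : Prop :=
  match e.op with
  | Op.read x => ¬ s.W x ≤ s.C e.tid
  | Op.write x => ¬ s.R x ≤ s.C e.tid ∨ ¬ s.W x ≤ s.C e.tid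
  | _ => False

/-- The state after the algorithm has processed the events of `σ` in order. -/
def runVC (σ : List (Event T L V)) : VCState T L V :=
  σ.foldl VCState.step VCState.initial

/-- The algorithm, run on `σ`, reports a race at the event `e`. -/
def ReportsRaceAt (σ : List (Event T L V)) (e : Event T L V) : Prop :=
  ∃ pre post : List (Event T L V), σ = pre ++ e :: post ∧ (runVC pre).DeclaresRace e

/-- `e` is a read or a write event. -/
def Event.IsAccess (e : Event T L V) : Prop :=
  ∃ x : V, e.op = Op.read x ∨ e.op = Op.write x

end SHB

namespace SHB

set_option linter.unusedSectionVars false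

variable {T L V : Type*} [DecidableEq T] [DecidableEq L] [DecidableEq V]

/-! ### Positions in a duplicate-free list -/

/-! Both sides of the theorem are compared with schedulable happens-before, `SchedHB`:
happens-before enlarged by an edge from each last write to its read. For a conflicting pair with `a`
before `e`, both amount to `a` not lying below any event of the thread of `e` that precedes `e` (`¬
KnownBefore σ a e`).

For races this is `hbSchedulableRace_iff`. If `a` lies below such a thread predecessor `p`, an
admissible reordering containing `e` must contain the whole path from `a` to `p` in order:
happens-before edges are respected, and each read on the path has a later event in its own thread,
so its last write is fixed. Then `p` would come after `a` and before `e`, which is impossible if `a`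
and `e` are the last two events. Conversely, the events below thread predecessors of `a` or of `e`,
kept in trace order and followed by `a` and `e`, form a reordering witnessing the race, because this
set is downward closed for `SchedHB`.

For the algorithm, the invariant `ClockInv` says that a clock dominates the local time of `a` in the
component of the thread of `a` exactly when `a` lies below what the clock stands for. A thread ticks
after a release, write or fork, so its later events have local times that the exported clock does
not reach. Only a join copies a clock without a tick, but a thread joined by another never acts
again; hence the exclusions by `Joined`. The race checks precede the import of `LW`, so they test
`KnownBefore` rather than `SchedHB` below `e` (`declaresRace_iff`). -/

theorem before_iff {σ : List (Event T L V)} (hn : σ.Nodup) {a b : Event T L V} :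
    Before σ a b ↔ b ∈ σ ∧ σ.idxOf a < σ.idxOf b := by
  induction σ with
  | nil => simp [Before]
  | cons c σ ih =>
    obtain ⟨hc, hn⟩ := List.nodup_cons.1 hn
    have ih := ih hn
    unfold Before at ih ⊢
    by_cases hca : c = a
    · subst hca
      rw [List.cons_sublist_cons, List.singleton_sublist]
      by_cases hcb : c = b
      · subst hcb; simp [hc]
      · simp [List.idxOf_cons_ne _ hcb, Ne.symm hcb]
    · have : [a, b].Sublist (c :: σ) ↔ [a, b].Sublist σ := by
        constructor
        · intro h
          rcases List.sublist_cons_iff.1 h with h | ⟨r, hr, -⟩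
          · exact h
          · simp only [List.cons.injEq] at hr; exact absurd hr.1.symm hca
        · exact fun h => h.cons _
      rw [this, ih, List.idxOf_cons_ne _ hca]
      by_cases hcb : c = b
      · subst hcb; simp [hc]
      · simp [List.idxOf_cons_ne _ hcb, Ne.symm hcb]

theorem Before.mem_left {σ : List (Event T L V)} {a b : Event T L V} (h : Before σ a b) :
    a ∈ σ := h.subset (by simp)

theorem Before.mem_right {σ : List (Event T L V)} {a b : Event T L V} (h : Before σ a b) :
    b ∈ σ := h.subset (by simp)

theorem Before.trans {σ : List (Event T L V)} (hn : σ.Nodup) {a b c : Event T L V}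
    (h : Before σ a b) (h' : Before σ b c) : Before σ a c := by
  rw [before_iff hn] at *
  exact ⟨h'.1, h.2.trans h'.2⟩

theorem Before.asymm {σ : List (Event T L V)} (hn : σ.Nodup) {a b : Event T L V}
    (h : Before σ a b) : ¬ Before σ b a := by
  rw [before_iff hn] at *
  exact fun h' => lt_asymm h.2 h'.2

theorem Before.ne {σ : List (Event T L V)} (hn : σ.Nodup) {a b : Event T L V}
    (h : Before σ a b) : a ≠ b := by
  rintro rfl
  exact h.asymm hn h

theorem before_trichotomy {σ : List (Event T L V)} (hn : σ.Nodup) {a b : Event T L V}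
    (ha : a ∈ σ) (hb : b ∈ σ) : Before σ a b ∨ a = b ∨ Before σ b a := by
  rw [before_iff hn, before_iff hn]
  rcases lt_trichotomy (σ.idxOf a) (σ.idxOf b) with h | h | h
  · exact Or.inl ⟨hb, h⟩
  · exact Or.inr (Or.inl ((List.idxOf_inj ha).1 h))
  · exact Or.inr (Or.inr ⟨ha, h⟩)

theorem mem_iff_before {pre post : List (Event T L V)} {e : Event T L V}
    (hn : (pre ++ e :: post).Nodup) {a : Event T L V} :
    a ∈ pre ↔ Before (pre ++ e :: post) a e := by
  have hd := List.disjoint_of_nodup_append hn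
  have he : e ∉ pre := fun h => hd h (by simp)
  rw [before_iff hn, List.idxOf_append_of_notMem he]
  constructor
  · intro h
    refine ⟨by simp, ?_⟩
    rw [List.idxOf_append_of_mem h]
    have := List.idxOf_lt_length_of_mem h
    omega
  · rintro ⟨-, h⟩
    by_contra ha
    rw [List.idxOf_append_of_notMem ha] at h
    simp at h

theorem before_filter {σ : List (Event T L V)} {P : Event T L V → Bool}
    {a b : Event T L V} : Before (σ.filter P) a b ↔ Before σ a b ∧ P a ∧ P b := by
  constructor
  · intro h
    exact ⟨List.Sublist.trans h List.filter_sublist, (List.mem_filter.1 h.mem_left).2,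
      (List.mem_filter.1 h.mem_right).2⟩
  · rintro ⟨h, ha, hb⟩
    have := h.filter P
    simpa [Before, ha, hb] using this

theorem IsTrace.nodup {σ : List (Event T L V)} (h : IsTrace σ) : σ.Nodup :=
  h.uid_nodup.of_map

theorem IsTrace.of_prefix {σ τ : List (Event T L V)} (h : IsTrace σ) (hp : τ <+: σ) :
    IsTrace τ where
  uid_nodup := (hp.sublist.map _).nodup h.uid_nodup
  locks l := by
    obtain ⟨ts, hts⟩ := h.locks l
    exact ⟨ts, ((hp.filter _).map _).trans hts⟩
  fork_first u e f hb := h.fork_first u e f (List.Sublist.trans hb hp.sublist)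
  join_last u j e hb := h.join_last u j e (List.Sublist.trans hb hp.sublist)

theorem exists_last {σ : List (Event T L V)} (hn : σ.Nodup) {P : Event T L V → Prop}
    (h : ∃ a ∈ σ, P a) : ∃ a ∈ σ, P a ∧ ∀ b, P b → ¬ Before σ a b := by
  classical
  obtain ⟨a, ha, hP⟩ := h
  obtain ⟨m, hm, hmax⟩ := Finset.exists_max_image (σ.toFinset.filter P) (fun b => σ.idxOf b)
    ⟨a, by simp [ha, hP]⟩
  simp only [Finset.mem_filter, List.mem_toFinset] at hm hmax
  refine ⟨m, hm.1, hm.2, fun b hb hmb => ?_⟩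
  rw [before_iff hn] at hmb
  exact absurd (hmax b ⟨hmb.1, hb⟩) (not_le.2 hmb.2)

theorem exists_isLastWrite {σ : List (Event T L V)} (hn : σ.Nodup) {w e : Event T L V} {x : V}
    (he : e.op = Op.read x) (hw : w.op = Op.write x) (h : Before σ w e) :
    ∃ w₀, IsLastWrite σ w₀ e := by
  obtain ⟨m, -, ⟨hm, hme⟩, hmax⟩ := exists_last hn
    (P := fun a => a.op = Op.write x ∧ Before σ a e) ⟨w, h.mem_left, hw, h⟩
  exact ⟨m, x, he, hm, hme, fun w' hw' hb => hmax w' ⟨hw', hb.2⟩ hb.1⟩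

/-! ### Schedulable happens-before -/

/-- The generators of happens-before: pairs of events of a common thread, and release–acquire
pairs of a common lock, in trace order. -/
def HBEdge (σ : List (Event T L V)) (a b : Event T L V) : Prop :=
  Before σ a b ∧
    ((∃ t : T, a.OfThread t ∧ b.OfThread t) ∨ ∃ l : L, a.op = Op.rel l ∧ b.op = Op.acq l)

/-- The generators of schedulable happens-before. -/
def SHBEdge (σ : List (Event T L V)) (a b : Event T L V) : Prop :=
  HBEdge σ a b ∨ IsLastWrite σ a b

/-- Schedulable happens-before: happens-before extended by the pairs of a last write and a read. -/
abbrev SchedHB (σ : List (Event T L V)) : Event T L V → Event T L V → Prop :=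
  Relation.ReflTransGen (SHBEdge σ)

theorem SHBEdge.before {σ : List (Event T L V)} {a b : Event T L V} (h : SHBEdge σ a b) :
    Before σ a b := by
  rcases h with h | ⟨x, -, -, h, -⟩
  · exact h.1
  · exact h

theorem HBEdge.happensBefore {σ : List (Event T L V)} {a b : Event T L V} (h : HBEdge σ a b) :
    HappensBefore σ a b := by
  have ht : TraceOrder σ a b := ⟨h.1.mem_left, h.1.mem_right, Or.inr h.1⟩
  rcases h.2 with hc | hl
  · exact .single (Or.inl (.single ⟨ht, hc⟩))
  · exact .single (Or.inr ⟨ht, hl⟩)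

/-- Flattens the two nested closures to strict edges; the reflexive generators are absorbed by
`refl`. This permits inspecting the last edge of a path. -/
theorem HappensBefore.reflTransGen {σ : List (Event T L V)} {a b : Event T L V}
    (h : HappensBefore σ a b) : Relation.ReflTransGen (HBEdge σ) a b := by
  refine Relation.TransGen.trans_induction_on h ?_ fun _ _ h₁ h₂ => h₁.trans h₂
  rintro a b (h | ⟨⟨-, -, h⟩, hl⟩)
  · refine Relation.TransGen.trans_induction_on h ?_ fun _ _ h₁ h₂ => h₁.trans h₂
    rintro a b ⟨⟨-, -, h⟩, hc⟩
    rcases h with rfl | h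
    · exact .refl
    · exact .single ⟨h, Or.inl hc⟩
  · rcases h with rfl | h
    · exact .refl
    · exact .single ⟨h, Or.inr hl⟩

theorem reflTransGen_hbEdge_le {σ : List (Event T L V)} {a b : Event T L V}
    (h : Relation.ReflTransGen (HBEdge σ) a b) : SchedHB σ a b :=
  Relation.ReflTransGen.mono (fun _ _ => Or.inl) _ _ h

theorem SchedHB.eq_or_before {σ : List (Event T L V)} (hn : σ.Nodup) {a b : Event T L V}
    (h : SchedHB σ a b) : a = b ∨ Before σ a b := by
  induction h with
  | refl => exact Or.inl rfl
  | tail _ h ih =>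
    rcases ih with rfl | ih
    · exact Or.inr h.before
    · exact Or.inr (ih.trans hn h.before)

theorem shb_of_common_thread {σ : List (Event T L V)} {a b : Event T L V} {t : T}
    (h : Before σ a b) (ha : a.OfThread t) (hb : b.OfThread t) : SchedHB σ a b :=
  .single (Or.inl ⟨h, Or.inl ⟨t, ha, hb⟩⟩)

/-- Neighbouring letters are either an acquire and its release by one thread, or a release and the
next acquire; each kind is an edge of happens-before. Transitivity then orders all events of a lock.
-/
theorem isChain_lock_word (l : L) (ts : List T) :
    (ts.flatMap (fun t => [(t, (Op.acq l : Op T L V)), (t, Op.rel l)])).IsChain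
      (fun p q => p.1 = q.1 ∨ (p.2 = Op.rel l ∧ q.2 = Op.acq l)) := by
  induction ts with
  | nil => simp
  | cons t ts ih =>
    cases ts with
    | nil => simp
    | cons s ts => simpa using ih

/-- Events of a common lock are ordered by schedulable happens-before. -/
theorem shb_of_common_lock {σ : List (Event T L V)} (hσ : IsTrace σ) {a b : Event T L V} {l : L}
    (h : Before σ a b) (ha : a.OfLock l) (hb : b.OfLock l) : SchedHB σ a b := by
  have hn := hσ.nodup
  obtain ⟨ts, hts⟩ := hσ.locks l
  have hc := (isChain_lock_word (V := V) l ts).prefix hts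
  rw [List.isChain_map] at hc
  have hnl : (lockProj σ l).Nodup := hn.filter _
  have hab : Before (lockProj σ l) a b := 
    before_filter.2 ⟨h, by simpa using ha, by simpa using hb⟩
  have hc' : (lockProj σ l).IsChain (SchedHB σ) := by
    rw [List.isChain_iff_getElem] at hc ⊢
    intro i hi
    have hbi : Before σ (lockProj σ l)[i] (lockProj σ l)[i + 1] := by
      have hp : (lockProj σ l).Pairwise (Before σ) :=
        List.pairwise_iff_forall_sublist.2 fun h => List.Sublist.trans h List.filter_sublist
      exact List.pairwise_iff_getElem.1 hp _ _ _ _ (Nat.lt_succ_self i)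
    rcases hc i hi with h | h
    · exact shb_of_common_thread hbi (Or.inl h) (Or.inl rfl)
    · exact .single (Or.inl ⟨hbi, Or.inr ⟨l, h⟩⟩)
  have hp : (lockProj σ l).Pairwise (SchedHB σ) := List.isChain_iff_pairwise.1 hc'
  exact (List.pairwise_iff_forall_sublist.1 hp) hab

/-! ### Characterisation of schedulable races -/

/-- `a` is below an event of the thread of `e` that precedes `e`. -/
def KnownBefore (σ : List (Event T L V)) (a e : Event T L V) : Prop :=
  ∃ p, Before σ p e ∧ p.OfThread e.tid ∧ SchedHB σ a p

theorem Conflicting.isAccess_left {a b : Event T L V} (h : Conflicting a b) : a.IsAccess := by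
  obtain ⟨-, x, h | h | h⟩ := h <;> exact ⟨x, by simp [h.1]⟩

theorem Conflicting.isAccess_right {a b : Event T L V} (h : Conflicting a b) : b.IsAccess := by
  obtain ⟨-, x, h | h | h⟩ := h <;> exact ⟨x, by simp [h.2]⟩

theorem Event.IsAccess.ofThread_iff {e : Event T L V} (h : e.IsAccess) {t : T} :
    e.OfThread t ↔ e.tid = t := by
  obtain ⟨x, h | h⟩ := h <;> simp [Event.OfThread, h]

theorem Event.IsAccess.not_ofLock {e : Event T L V} (h : e.IsAccess) (l : L) : ¬ e.OfLock l := by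
  obtain ⟨x, h | h⟩ := h <;> simp [Event.OfLock, h]

theorem Event.IsAccess.ne_acq {e : Event T L V} (h : e.IsAccess) (l : L) : e.op ≠ Op.acq l := by
  obtain ⟨x, h | h⟩ := h <;> simp [h]

/-! ### A schedulable race is unknown to the second thread -/

theorem not_knownBefore_of_race {σ : List (Event T L V)} (hσ : IsTrace σ) {a e : Event T L V}
    (h : HBSchedulableRace σ a e) : ¬ KnownBefore σ a e := by
  rintro ⟨p, hpe, hp, hap⟩
  obtain ⟨-, hc, τ, ⟨hτ, -, hlw⟩, hr, ρ, -, hρ⟩ := h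
  have hnτ := hτ.nodup
  have heτ : e ∈ τ := by rcases hρ with rfl | rfl <;> simp
  have hpe' : HBEdge σ p e := ⟨hpe, Or.inl ⟨e.tid, hp, Or.inl rfl⟩⟩
  have key : p ∈ τ ∧ Before τ p e := by
    obtain ⟨h, -, -, h'⟩ := hr p e hpe'.happensBefore heτ
    exact ⟨h, h'.resolve_left (hpe.ne hσ.nodup)⟩
  have hpa : p ≠ a := by
    rintro rfl
    exact hc.1 (hc.isAccess_left.ofThread_iff.1 hp)
  -- Every event on the path from `a` to `p` is in `τ`, in order, and is followed by an event
  -- of its own thread if it is a read.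
  have walk : ∀ b, SchedHB σ b p → b ∈ τ ∧ (b = p ∨ Before τ b p) ∧
      ((∃ x, b.op = Op.read x) → ∃ c, Before τ b c ∧ c.OfThread b.tid) := by
    intro b hb
    induction hb using Relation.ReflTransGen.head_induction_on with
    | refl =>
      refine ⟨key.1, Or.inl rfl, ?_⟩
      rintro ⟨x, hx⟩
      refine ⟨e, key.2, ?_⟩
      rw [(Event.IsAccess.ofThread_iff ⟨x, Or.inl hx⟩).1 hp]
      exact Or.inl rfl
    | head h _ ih =>
      rename_i b c _
      obtain ⟨hc, hcp, hcr⟩ := ih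
      have aux : Before τ b c → b = p ∨ Before τ b p := fun h => by
        rcases hcp with rfl | hcp
        · exact Or.inr h
        · exact Or.inr (h.trans hnτ hcp)
      rcases h with h | h
      · obtain ⟨-, -, -, hbc⟩ := hr b c h.happensBefore hc
        have hbc := hbc.resolve_left (h.1.ne hσ.nodup)
        refine ⟨hbc.mem_left, aux hbc, ?_⟩
        rintro ⟨x, hx⟩
        refine ⟨c, hbc, ?_⟩
        -- A read is not a release, so the happens-before edge leaving it is a thread edge and leads
        -- to a later event of its own thread.
        rcases h.2 with ⟨t, ht, ht'⟩ | ⟨l, hl, -⟩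
        · rwa [(Event.IsAccess.ofThread_iff ⟨x, Or.inl hx⟩).1 ht]
        · simp [hx] at hl
      · obtain ⟨x, hcx, hbx, -, -⟩ := id h
        -- The later event of the thread of `c` removes the exemption for final reads, so `τ` must
        -- preserve the last write of `c`.
        have hlast : (threadProj τ c.tid).getLast? ≠ some c := by
          obtain ⟨d, hcd, hd⟩ := hcr ⟨x, hcx⟩
          have hcd' : Before (threadProj τ c.tid) c d :=
            before_filter.2 ⟨hcd, by simp [Event.OfThread], by simpa using hd⟩
          intro hl
          obtain ⟨ys, hys⟩ := List.getLast?_eq_some_iff.1 hl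
          have hnn : (threadProj τ c.tid).Nodup := hnτ.filter _
          rw [hys] at hcd' hnn
          rcases List.mem_append.1 hcd'.mem_right with hd | hd
          · exact hcd'.asymm hnn ((mem_iff_before hnn).1 hd)
          · exact hcd'.ne hnn (List.mem_singleton.1 hd).symm
        obtain ⟨-, -, -, hbc, -⟩ := (hlw c x hc hcx hlast b).2 h
        refine ⟨hbc.mem_left, aux hbc, ?_⟩
        rintro ⟨y, hy⟩
        simp [hbx] at hy
  obtain ⟨-, hap', -⟩ := walk a hap
  have hap' := hap'.resolve_left (Ne.symm hpa)
  -- In `τ`, `p` comes strictly after `a`. If `τ` ends in `a, e`, this leaves only `p = e`; if it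
  -- ends in `e, a`, nothing comes after `a`.
  rcases hρ with rfl | rfl
  · have h1 : p ∉ ρ := fun h => hap'.asymm hnτ ((mem_iff_before hnτ).1 h)
    rcases List.mem_append.1 key.1 with h | h
    · exact h1 h
    · simp only [List.mem_cons, List.not_mem_nil, or_false] at h
      exact h.elim hpa (hpe.ne hσ.nodup)
  · have hnτ' := hnτ
    rw [show ρ ++ [e, a] = (ρ ++ [e]) ++ a :: [] by simp] at hnτ' hap' key
    rcases List.mem_append.1 key.1 with h | h
    · exact hap'.asymm hnτ' ((mem_iff_before hnτ').1 h)
    · exact hpa (List.mem_singleton.1 h)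

/-! ### Construction of a reordering that exhibits the race -/

/-- Once `P` fails it fails for good. Applied to thread and lock projections, on which `SchedHB`
contains the trace order, so that a downward closed set cuts out an initial segment. -/
theorem filter_prefix_of_downward_closed {α : Type*} {P : α → Bool} {l : List α}
    (h : l.Pairwise fun a b => P b → P a) : l.filter P <+: l := by
  induction l with
  | nil => simp
  | cons a l ih =>
    obtain ⟨ha, h⟩ := List.pairwise_cons.1 h
    by_cases hP : P a
    · rw [List.filter_cons_of_pos hP]
      exact (List.prefix_cons_inj a).2 (ih h)
    · rw [List.filter_cons_of_neg hP, List.filter_eq_nil_iff.2 fun b hb hPb => hP (ha b hb hPb)]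
      exact List.nil_prefix

theorem before_append {l r : List (Event T L V)} {x y : Event T L V} :
    Before (l ++ r) x y ↔ Before l x y ∨ (x ∈ l ∧ y ∈ r) ∨ Before r x y := by
  constructor
  · intro h
    obtain ⟨l₁, l₂, he, h₁, h₂⟩ := List.sublist_append_iff.1 h
    rcases l₁ with _ | ⟨b, _ | ⟨c, l₁⟩⟩
    · rw [List.nil_append] at he
      exact Or.inr (Or.inr (by rwa [Before, he]))
    · simp only [List.cons_append, List.nil_append, List.cons.injEq] at he
      obtain ⟨rfl, rfl⟩ := he
      exact Or.inr (Or.inl ⟨List.singleton_sublist.1 h₁, List.singleton_sublist.1 h₂⟩)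
    · simp only [List.cons_append, List.cons.injEq] at he
      obtain ⟨rfl, rfl, he⟩ := he
      obtain ⟨rfl, rfl⟩ := List.append_eq_nil_iff.1 he.symm
      exact Or.inl h₁
  · rintro (h | ⟨h, h'⟩ | h)
    · exact List.Sublist.trans h (List.sublist_append_left _ _)
    · exact (List.singleton_sublist.2 h).append (List.singleton_sublist.2 h')
    · exact List.Sublist.trans h (List.sublist_append_right _ _)

theorem KnownBefore.head {σ : List (Event T L V)} {a b e : Event T L V} (h : SchedHB σ a b)
    (hb : KnownBefore σ b e) : KnownBefore σ a e := by
  obtain ⟨p, hpe, hp, hbp⟩ := hb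
  exact ⟨p, hpe, hp, h.trans hbp⟩

theorem KnownBefore.of_thread {σ : List (Event T L V)} {a e : Event T L V} (h : Before σ a e)
    (ha : a.OfThread e.tid) : KnownBefore σ a e := ⟨a, h, ha, .refl⟩

theorem KnownBefore.before {σ : List (Event T L V)} (hn : σ.Nodup) {a e : Event T L V}
    (h : KnownBefore σ a e) : Before σ a e := by
  obtain ⟨p, hpe, -, hap⟩ := h
  rcases hap.eq_or_before hn with rfl | h
  · exact hpe
  · exact h.trans hn hpe

/-- If `P` holds at the events of the thread of `e` that precede `e`, and at none of the others, then
the part of the thread in `P`, extended by `e`, is a prefix of the thread. -/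
theorem threadProj_filter_concat_prefix {σ : List (Event T L V)} (hσ : IsTrace σ)
    {P : Event T L V → Bool} {e : Event T L V} (he : e ∈ σ) (hPe : ¬ P e)
    (hbefore : ∀ a, Before σ a e → a.OfThread e.tid → P a)
    (hafter : ∀ a, Before σ e a → a.OfThread e.tid → ¬ P a) :
    (threadProj σ e.tid).filter P ++ [e] <+: threadProj σ e.tid := by
  have hn := hσ.nodup
  obtain ⟨pre, post, rfl⟩ := List.append_of_mem he
  have h₁ : (threadProj pre e.tid).filter P = threadProj pre e.tid := by
    refine List.filter_eq_self.2 fun a ha => ?_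
    obtain ⟨ha, hat⟩ := List.mem_filter.1 ha
    exact hbefore a ((mem_iff_before hn).1 ha) (by simpa using hat)
  have h₂ : (threadProj post e.tid).filter P = [] := by
    refine List.filter_eq_nil_iff.2 fun a ha => ?_
    obtain ⟨ha, hat⟩ := List.mem_filter.1 ha
    refine hafter a ?_ (by simpa using hat)
    rw [before_append]
    refine Or.inr (Or.inr ?_)
    exact (List.singleton_sublist.2 ha).cons_cons e
  have h₃ : threadProj (pre ++ e :: post) e.tid =
      threadProj pre e.tid ++ e :: threadProj post e.tid := by
    simp [threadProj, Event.OfThread]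
  rw [h₃, List.filter_append, List.filter_cons_of_neg hPe, h₁, h₂, List.append_nil]
  exact ⟨threadProj post e.tid, by simp⟩

theorem race_of_not_knownBefore {σ : List (Event T L V)} (hσ : IsTrace σ) {a e : Event T L V}
    (hae : Before σ a e) (hc : Conflicting a e) (hk : ¬ KnownBefore σ a e) :
    HBSchedulableRace σ a e := by
  classical
  have hn := hσ.nodup
  have ha := hae.mem_left
  have he := hae.mem_right
  have hA := hc.isAccess_left
  have hE := hc.isAccess_right
  -- The smallest downward closed set containing the thread predecessors of `a` and of `e`. Last
  -- writes of `a` and `e` themselves are not forced in, since both become final in their threads.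
  set P : Event T L V → Bool := fun f => decide (KnownBefore σ f a ∨ KnownBefore σ f e) with hPdef
  have hP : ∀ f, P f ↔ KnownBefore σ f a ∨ KnownBefore σ f e := fun f => by simp [hPdef]
  have hPd : ∀ f g, SchedHB σ f g → P g → P f := fun f g h hg => by
    rw [hP] at *
    exact hg.imp (KnownBefore.head h) (KnownBefore.head h)
  have hPa : ¬ P a := by
    rw [hP]
    rintro (h | h)
    · exact (h.before hn).ne hn rfl
    · exact hk h
  have hPe : ¬ P e := by
    rw [hP]
    rintro (h | h)
    · exact (h.before hn).asymm hn hae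
    · exact (h.before hn).ne hn rfl
  have hthr : ∀ c, (c = a ∨ c = e) → ∀ f, f ∈ σ → f.OfThread c.tid → (P f ↔ Before σ f c) := by
    intro c hc f hf hft
    have hcσ : c ∈ σ := by rcases hc with rfl | rfl <;> assumption
    have hPc : ¬ P c := by rcases hc with rfl | rfl <;> assumption
    constructor
    · intro hPf
      rcases before_trichotomy hn hf hcσ with h | rfl | h
      · exact h
      · exact absurd hPf hPc
      · exact absurd (hPd _ _ (shb_of_common_thread h (Or.inl rfl) hft) hPf) hPc
    · intro h
      rw [hP]
      rcases hc with rfl | rfl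
      · exact Or.inl (.of_thread h hft)
      · exact Or.inr (.of_thread h hft)
  set τ := σ.filter P ++ [a, e] with hτdef
  have hsub : ∀ f, f ∈ τ → f ∈ σ := by
    intro f hf
    simp only [hτdef, List.mem_append, List.mem_filter, List.mem_cons, List.not_mem_nil,
      or_false] at hf
    rcases hf with hf | rfl | rfl
    · exact hf.1
    · exact ha
    · exact he
  have hnτ : τ.Nodup := by
    refine List.nodup_append'.2 ⟨hn.filter _, by simpa using hae.ne hn, ?_⟩
    intro f hf hf'
    have hf := (List.mem_filter.1 hf).2
    simp only [List.mem_cons, List.not_mem_nil, or_false] at hf'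
    rcases hf' with rfl | rfl <;> contradiction
  have hbτ : ∀ f g, Before τ f g ↔ (Before σ f g ∧ P f ∧ P g) ∨
      ((f ∈ σ ∧ P f) ∧ (g = a ∨ g = e)) ∨ (f = a ∧ g = e) := by
    intro f g
    rw [hτdef, before_append, before_filter]
    have : Before [a, e] f g ↔ f = a ∧ g = e := by
      constructor
      · intro h
        have := h.eq_of_length (by simp)
        simpa using this
      · rintro ⟨rfl, rfl⟩
        exact List.Sublist.refl _
    simp [this]
  -- Events of a common thread keep their trace order, so the fork and join conditions are inherited
  -- from `σ`.
  have hcommon : ∀ f g t, Before τ f g → f.OfThread t → g.OfThread t → Before σ f g := by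
    intro f g t h hf hg
    rcases (hbτ f g).1 h with h | ⟨⟨hfσ, hPf⟩, hgc⟩ | ⟨rfl, rfl⟩
    · exact h.1
    · have hgA : g.IsAccess := by rcases hgc with rfl | rfl <;> assumption
      rw [hgA.ofThread_iff] at hg
      subst hg
      exact (hthr g hgc f hfσ hf).1 hPf
    · exact hae
  have hτ : IsTrace τ := by
    refine ⟨?_, ?_, ?_, ?_⟩
    · refine hnτ.map_on fun f hf g hg h => ?_
      exact List.inj_on_of_nodup_map hσ.uid_nodup (hsub f hf) (hsub g hg) h
    · intro l
      obtain ⟨ts, hts⟩ := hσ.locks l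
      refine ⟨ts, List.IsPrefix.trans (List.IsPrefix.map _ ?_) hts⟩
      -- The appended `a` and `e` are accesses, hence invisible to locks.
      have h : lockProj τ l = (lockProj σ l).filter P := by
        simp [hτdef, lockProj, hA.not_ofLock, hE.not_ofLock, List.filter_filter, Bool.and_comm]
      rw [h]
      refine filter_prefix_of_downward_closed (List.pairwise_iff_forall_sublist.2 ?_)
      intro f g hfg
      obtain ⟨h, hf, hg⟩ := before_filter.1 hfg
      exact hPd _ _ (shb_of_common_lock hσ h (by simpa using hf) (by simpa using hg))
    · intro u f g h hg hf
      exact hσ.fork_first u f g (hcommon f g u h hf (Or.inr (Or.inl hg))) hg hf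
    · intro u j f h hj hf
      exact hσ.join_last u j f (hcommon j f u h (Or.inr (Or.inr hj)) hf) hj hf
  have hproj : ∀ t, threadProj τ t = (threadProj σ t).filter P ++
      (if a.tid = t then [a] else if e.tid = t then [e] else []) := by
    intro t
    have := hc.1
    simp only [hτdef, threadProj, List.filter_append, List.filter_filter, List.filter_cons,
      hA.ofThread_iff, hE.ofThread_iff, decide_eq_true_eq, List.filter_nil]
    congr 1
    · exact List.filter_congr fun f _ => Bool.and_comm _ _
    · split_ifs <;> simp_all
  refine ⟨⟨ha, he, Or.inr hae⟩, hc, τ, ⟨hτ, ?_, ?_⟩, ?_, σ.filter P,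
    hτ.of_prefix (List.prefix_append _ _), Or.inl rfl⟩
  · intro t
    have haft : ∀ c, (c = a ∨ c = e) → ∀ f, Before σ c f → f.OfThread c.tid → ¬ P f :=
      fun c hc f h hf hPf => ((hthr c hc f h.mem_right hf).1 hPf).asymm hn h
    rw [hproj]
    split_ifs with h h
    · subst h
      exact threadProj_filter_concat_prefix hσ ha hPa
        (fun f h hf => (hthr a (Or.inl rfl) f h.mem_left hf).2 h) (haft a (Or.inl rfl))
    · subst h
      exact threadProj_filter_concat_prefix hσ he hPe
        (fun f h hf => (hthr e (Or.inr rfl) f h.mem_left hf).2 h) (haft e (Or.inr rfl))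
    · rw [List.append_nil]
      refine filter_prefix_of_downward_closed (List.pairwise_iff_forall_sublist.2 ?_)
      intro f g hfg
      obtain ⟨h, hf, hg⟩ := before_filter.1 hfg
      exact hPd _ _ (shb_of_common_thread h (t := t) (by simpa using hf) (by simpa using hg))
  · intro r x hr hrx hlast w
    -- `a` and `e` belong to different threads and each ends its own projection, so neither is
    -- subject to the condition on reads.
    have hrae : r ≠ a ∧ r ≠ e := by
      constructor <;> rintro rfl <;> apply hlast <;> rw [hproj] <;> simp [hc.1]
    have hPr : P r := by
      simp only [hτdef, List.mem_append, List.mem_filter, List.mem_cons, List.not_mem_nil,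
        or_false, hrae.1, hrae.2] at hr
      exact hr.2
    have hbr : ∀ f, Before τ f r ↔ Before σ f r ∧ P f := fun f => by
      rw [hbτ]; simp [hrae.1, hrae.2, hPr]
    constructor
    · rintro ⟨y, hy, hw, hwr, hmax⟩
      obtain ⟨hwr, hPw⟩ := (hbr w).1 hwr
      obtain ⟨w₀, hw₀⟩ := exists_isLastWrite hn hy hw hwr
      -- Downward closure along the last-write edge: this is where happens-before alone would not
      -- suffice.
      have hPw₀ : P w₀ := hPd _ _ (.single (Or.inr hw₀)) hPr
      obtain ⟨z, hz, hw₀w, hw₀r, hmax₀⟩ := id hw₀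
      obtain rfl : y = z := by simpa [hy] using hz
      rcases before_trichotomy hn hwr.mem_left hw₀r.mem_left with h | rfl | h
      · exact absurd ⟨(hbτ _ _).2 (Or.inl ⟨h, hPw, hPw₀⟩), (hbr _).2 ⟨hw₀r, hPw₀⟩⟩ (hmax w₀ hw₀w)
      · exact hw₀
      · exact absurd ⟨h, hwr⟩ (hmax₀ w hw)
    · intro hw₀
      have hPw : P w := hPd _ _ (.single (Or.inr hw₀)) hPr
      obtain ⟨y, hy, hw, hwr, hmax⟩ := hw₀
      refine ⟨y, hy, hw, (hbr w).2 ⟨hwr, hPw⟩, fun w' hw' ⟨h₁, h₂⟩ => hmax w' hw' ?_⟩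
      obtain ⟨h₂, hPw'⟩ := (hbr w').1 h₂
      refine ⟨?_, h₂⟩
      rcases (hbτ w w').1 h₁ with h | ⟨-, rfl | rfl⟩ | ⟨rfl, rfl⟩
      · exact h.1
      all_goals contradiction
  · intro f g hfg hg
    have hstep : f = g ∨ (Before σ f g ∧ P f) := by
      have hg' : P g ∨ (g = a ∨ g = e) := by
        simp only [hτdef, List.mem_append, List.mem_filter, List.mem_cons, List.not_mem_nil,
          or_false] at hg
        exact hg.imp_left And.right
      have hh := hfg.reflTransGen
      rcases (reflTransGen_hbEdge_le hh).eq_or_before hn with h | h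
      · exact Or.inl h
      · refine Or.inr ⟨h, ?_⟩
        rcases hg' with hPg | hgc
        · exact hPd _ _ (reflTransGen_hbEdge_le hh) hPg
        · have hgA : g.IsAccess := by rcases hgc with rfl | rfl <;> assumption
          -- An access is not an acquire, so the final edge into `g` comes from a thread
          -- predecessor, which satisfies `P`.
          rcases Relation.ReflTransGen.cases_tail hh with rfl | ⟨p, hfp, hpg, hp⟩
          · exact absurd rfl (h.ne hn)
          · rcases hp with ⟨t, hpt, hgt⟩ | ⟨l, -, hl⟩
            · rw [hgA.ofThread_iff] at hgt
              subst hgt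
              exact hPd _ _ (reflTransGen_hbEdge_le hfp)
                ((hthr g hgc p hpg.mem_left hpt).2 hpg)
            · exact absurd hl (hgA.ne_acq l)
    rcases hstep with rfl | ⟨h, hPf⟩
    · exact ⟨hg, hg, hg, Or.inl rfl⟩
    · have hb : Before τ f g := by
        rw [hbτ]
        simp only [hτdef, List.mem_append, List.mem_filter, List.mem_cons, List.not_mem_nil,
          or_false] at hg
        rcases hg with hg | hg
        · exact Or.inl ⟨h, hPf, hg.2⟩
        · exact Or.inr (Or.inl ⟨⟨h.mem_left, hPf⟩, hg⟩)
      exact ⟨hb.mem_left, hb.mem_left, hg, Or.inr hb⟩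

theorem hbSchedulableRace_iff {σ : List (Event T L V)} (hσ : IsTrace σ) {a e : Event T L V} :
    HBSchedulableRace σ a e ↔ Before σ a e ∧ Conflicting a e ∧ ¬ KnownBefore σ a e := by
  constructor
  · intro h
    refine ⟨h.1.2.2.resolve_left ?_, h.2.1, not_knownBefore_of_race hσ h⟩
    rintro rfl
    exact h.2.1.1 rfl
  · rintro ⟨h, hc, hk⟩
    exact race_of_not_knownBefore hσ h hc hk

/-! ### One step of the algorithm -/

/-- The clock of the thread of `e` after the joins of the handler of `e`, and before it ticks. -/
def stamp (s : VCState T L V) (e : Event T L V) : VTime T :=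
  match e.op with
  | Op.acq l => s.C e.tid ⊔ s.Lk l
  | Op.join u => s.C e.tid ⊔ s.C u
  | Op.read x => s.C e.tid ⊔ s.LW x
  | _ => s.C e.tid

theorem step_C_of_ne {s : VCState T L V} {e : Event T L V} {r : T} (hr : r ≠ e.tid)
    (hf : e.op ≠ Op.fork r) : (s.step e).C r = s.C r := by
  cases ho : e.op <;> simp_all [VCState.step, VCState.read, VCState.write, VCState.acquire,
    VCState.release, VCState.fork, VCState.join, VCState.tick, VCState.setC, VCState.setLk,
    VCState.setLW, VCState.recordRead, VCState.recordWrite, Function.update_of_ne]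
  rw [Function.update_of_ne (Ne.symm hf)]

theorem step_C_tid_of_ne {s : VCState T L V} {e : Event T L V} {r : T} (hr : r ≠ e.tid) :
    (s.step e).C e.tid r = stamp s e r := by
  cases ho : e.op <;> simp [stamp, ho, hr, VCState.step, VCState.read, VCState.write,
    VCState.acquire, VCState.release, VCState.fork, VCState.join, VCState.tick, VCState.setC,
    VCState.setLk, VCState.setLW, VCState.recordRead, VCState.recordWrite]
  rename_i u
  by_cases hu : e.tid = u
  · subst hu; simp [hr]
  · rw [Function.update_of_ne hu]

/-- The hypothesis `hf` covers a thread that forks itself: the handler resets its own entry to 1,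
which is harmless when the entry is already 1. -/
theorem step_C_tid_tid {s : VCState T L V} {e : Event T L V}
    (hf : ∀ u, e.op = Op.fork u → s.C u u = 1) :
    (s.step e).C e.tid e.tid = stamp s e e.tid ∨
      (s.step e).C e.tid e.tid = stamp s e e.tid + 1 := by
  cases ho : e.op <;> simp [stamp, ho, VCState.step, VCState.read, VCState.write,
    VCState.acquire, VCState.release, VCState.fork, VCState.join, VCState.tick, VCState.setC,
    VCState.setLk, VCState.setLW, VCState.recordRead, VCState.recordWrite]
  rename_i u
  by_cases hu : e.tid = u
  · have := hf u ho
    subst hu; simp [this]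
  · rw [Function.update_of_ne hu]; simp

theorem step_C_tid_tid_of_tick {s : VCState T L V} {e : Event T L V}
    (hf : ∀ u, e.op = Op.fork u → s.C u u = 1)
    (h : (∃ l, e.op = Op.rel l) ∨ (∃ x, e.op = Op.write x) ∨ ∃ u, e.op = Op.fork u) :
    (s.step e).C e.tid e.tid = stamp s e e.tid + 1 := by
  cases ho : e.op <;> simp [stamp, ho, VCState.step, VCState.write,
    VCState.release, VCState.fork, VCState.tick, VCState.setC,
    VCState.setLk, VCState.setLW, VCState.recordWrite] at h ⊢
  rename_i u
  by_cases hu : e.tid = u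
  · have := hf u ho
    subst hu; simp [this]
  · rw [Function.update_of_ne hu]

theorem step_C_fork {s : VCState T L V} {e : Event T L V} {r : T} (hr : r ≠ e.tid)
    (hf : e.op = Op.fork r) : (s.step e).C r = Function.update (stamp s e) r 1 := by
  simp [stamp, hf, hr, VCState.step, VCState.fork, VCState.tick, VCState.setC]

theorem step_Lk {s : VCState T L V} {e : Event T L V} {l : L} :
    (s.step e).Lk l = if e.op = Op.rel l then stamp s e else s.Lk l := by
  cases ho : e.op <;> simp [stamp, ho, VCState.step, VCState.read, VCState.write,
    VCState.acquire, VCState.release, VCState.fork, VCState.join, VCState.tick, VCState.setC,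
    VCState.setLk, VCState.setLW, VCState.recordRead, VCState.recordWrite,
    Function.update_apply, eq_comm]

theorem step_LW {s : VCState T L V} {e : Event T L V} {x : V} :
    (s.step e).LW x = if e.op = Op.write x then stamp s e else s.LW x := by
  cases ho : e.op <;> simp [stamp, ho, VCState.step, VCState.read, VCState.write,
    VCState.acquire, VCState.release, VCState.fork, VCState.join, VCState.tick, VCState.setC,
    VCState.setLk, VCState.setLW, VCState.recordRead, VCState.recordWrite,
    Function.update_apply, eq_comm]

theorem step_R {s : VCState T L V} {e : Event T L V} {x : V} {r : T} :
    (s.step e).R x r = if e.op = Op.read x ∧ e.tid = r then stamp s e r else s.R x r := by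
  cases ho : e.op <;> simp [stamp, ho, VCState.step, VCState.read, VCState.write,
    VCState.acquire, VCState.release, VCState.fork, VCState.join, VCState.tick, VCState.setC,
    VCState.setLk, VCState.setLW, VCState.recordRead, VCState.recordWrite]
  rename_i y
  by_cases hy : y = x
  · subst hy
    by_cases hr : e.tid = r
    · subst hr; simp
    · simp [hr, Function.update_of_ne (Ne.symm hr)]
  · simp [hy, Function.update_of_ne (Ne.symm hy)]

theorem step_W {s : VCState T L V} {e : Event T L V} {x : V} {r : T} :
    (s.step e).W x r = if e.op = Op.write x ∧ e.tid = r then stamp s e r else s.W x r := by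
  cases ho : e.op <;> simp [stamp, ho, VCState.step, VCState.read, VCState.write,
    VCState.acquire, VCState.release, VCState.fork, VCState.join, VCState.tick, VCState.setC,
    VCState.setLk, VCState.setLW, VCState.recordRead, VCState.recordWrite]
  rename_i y
  by_cases hy : y = x
  · subst hy
    by_cases hr : e.tid = r
    · subst hr; simp
    · simp [hr, Function.update_of_ne (Ne.symm hr)]
  · simp [hy, Function.update_of_ne (Ne.symm hy)]

/-! ### The invariant -/

/-- The component of the thread of `a` in its own clock when the algorithm arrives at `a`. -/
def localTime (σ : List (Event T L V)) (a : Event T L V) : ℕ :=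
  (runVC (σ.takeWhile (fun b => decide (b ≠ a)))).C a.tid a.tid

theorem localTime_eq {pre post : List (Event T L V)} {e : Event T L V}
    (hn : (pre ++ e :: post).Nodup) :
    localTime (pre ++ e :: post) e = (runVC pre).C e.tid e.tid := by
  have he : e ∉ pre := fun h => (List.disjoint_of_nodup_append hn) h (by simp)
  have h : ∀ b ∈ pre, decide (b ≠ e) = true := fun b hb => by
    simpa using fun h : b = e => he (h ▸ hb)
  rw [localTime, List.takeWhile_append_of_pos h]
  simp

/-- The thread `u` has been joined by another thread. -/
def Joined (pre : List (Event T L V)) (u : T) : Prop :=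
  ∃ j ∈ pre, j.op = Op.join u ∧ j.tid ≠ u

/-- `a` is below an event of the thread `t` in `pre`. -/
def Known (σ pre : List (Event T L V)) (t : T) (a : Event T L V) : Prop :=
  ∃ p ∈ pre, p.OfThread t ∧ SchedHB σ a p

/-- `a` is below a release of the lock `l` in `pre`. -/
def Released (σ pre : List (Event T L V)) (l : L) (a : Event T L V) : Prop :=
  ∃ p ∈ pre, p.op = Op.rel l ∧ SchedHB σ a p

/-- `a` is below the last write of `x` in `pre`. -/
def Written (σ pre : List (Event T L V)) (x : V) (a : Event T L V) : Prop :=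
  ∃ p ∈ pre, p.op = Op.write x ∧ (∀ q ∈ pre, q.op = Op.write x → ¬ Before σ p q) ∧ SchedHB σ a p

/-- The relation of the state after the prefix `pre` of `σ` to schedulable happens-before. -/
structure ClockInv (σ pre : List (Event T L V)) : Prop where
  lt_C : ∀ t r, ¬ Joined pre r → t ≠ r → (runVC pre).C t r < (runVC pre).C r r
  lt_Lk : ∀ l r, ¬ Joined pre r → (runVC pre).Lk l r < (runVC pre).C r r
  lt_LW : ∀ x r, ¬ Joined pre r → (runVC pre).LW x r < (runVC pre).C r r
  C_fresh : ∀ u, (∀ a ∈ pre, ¬ a.OfThread u) → (runVC pre).C u u = 1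
  mem_C : ∀ t, ¬ Joined pre t → ∀ a ∈ pre,
    (localTime σ a ≤ (runVC pre).C t a.tid ↔ Known σ pre t a)
  mem_Lk : ∀ l, ∀ a ∈ pre, (localTime σ a ≤ (runVC pre).Lk l a.tid ↔ Released σ pre l a)
  mem_LW : ∀ x, ∀ a ∈ pre, (localTime σ a ≤ (runVC pre).LW x a.tid ↔ Written σ pre x a)
  join_le : ∀ j ∈ pre, ∀ u, j.op = Op.join u → (runVC pre).C u ≤ (runVC pre).C j.tid
  le_R : ∀ x, ∀ a ∈ pre, a.op = Op.read x → localTime σ a ≤ (runVC pre).R x a.tid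
  R_eq : ∀ x r, (runVC pre).R x r = 0 ∨
    ∃ a ∈ pre, a.op = Op.read x ∧ a.tid = r ∧ (runVC pre).R x r = localTime σ a
  le_W : ∀ x, ∀ a ∈ pre, a.op = Op.write x → localTime σ a ≤ (runVC pre).W x a.tid
  W_eq : ∀ x r, (runVC pre).W x r = 0 ∨
    ∃ a ∈ pre, a.op = Op.write x ∧ a.tid = r ∧ (runVC pre).W x r = localTime σ a

/-! ### Clocks and predecessors at the arrival of an event -/

theorem clockInv_nil (σ : List (Event T L V)) : ClockInv σ [] := by
  constructor <;> simp +contextual [runVC, VCState.initial, Joined, Function.update_apply, eq_comm]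

theorem runVC_concat (pre : List (Event T L V)) (e : Event T L V) :
    runVC (pre ++ [e]) = (runVC pre).step e := by
  simp [runVC]

theorem mem_of_schedHB {pre post : List (Event T L V)} {e : Event T L V}
    (hn : (pre ++ e :: post).Nodup) {a p : Event T L V}
    (h : SchedHB (pre ++ e :: post) a p) (hp : p ∈ pre) : a ∈ pre := by
  rw [mem_iff_before hn] at *
  rcases h.eq_or_before hn with rfl | h
  · exact hp
  · exact h.trans hn hp

/-- The predecessors of an event in schedulable happens-before. -/
theorem schedHB_iff {pre post : List (Event T L V)} {e : Event T L V}
    (hσ : IsTrace (pre ++ e :: post)) {a : Event T L V} (ha : a ∈ pre) :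
    SchedHB (pre ++ e :: post) a e ↔
      (∃ t, e.OfThread t ∧ Known (pre ++ e :: post) pre t a) ∨
      (∃ l, e.op = Op.acq l ∧ Released (pre ++ e :: post) pre l a) ∨
      (∃ x, e.op = Op.read x ∧ Written (pre ++ e :: post) pre x a) := by
  have hn := hσ.nodup
  constructor
  · intro h
    rcases Relation.ReflTransGen.cases_tail h with rfl | ⟨p, hap, hp⟩
    · exact absurd rfl (((mem_iff_before hn).1 ha).ne hn)
    have hpp := (mem_iff_before hn).2 hp.before
    rcases hp with ⟨-, ⟨t, hpt, het⟩ | ⟨l, hpl, hel⟩⟩ | ⟨x, hex, hpx, -, hmax⟩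
    · exact Or.inl ⟨t, het, p, hpp, hpt, hap⟩
    · exact Or.inr (Or.inl ⟨l, hel, p, hpp, hpl, hap⟩)
    · exact Or.inr (Or.inr ⟨x, hex, p, hpp, hpx,
        fun q hq hqx hpq => hmax q hqx ⟨hpq, (mem_iff_before hn).1 hq⟩, hap⟩)
  · rintro (⟨t, het, p, hpp, hpt, hap⟩ | ⟨l, hel, p, hpp, hpl, hap⟩ | ⟨x, hex, p, hpp, hpx, hm, hap⟩)
      <;> have hpe := (mem_iff_before hn).1 hpp
      <;> refine hap.tail ?_
    · exact Or.inl ⟨hpe, Or.inl ⟨t, hpt, het⟩⟩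
    · exact Or.inl ⟨hpe, Or.inr ⟨l, hpl, hel⟩⟩
    · exact Or.inr ⟨x, hex, hpx, hpe,
        fun q hqx hq => hm q ((mem_iff_before hn).2 hq.2) hqx hq.1⟩

/-- After a join by another thread, only that thread may repeat the join. So the exclusions by
`Joined` in `ClockInv` never affect the acting thread. -/
theorem not_joined_tid {pre post : List (Event T L V)} {e : Event T L V}
    (hσ : IsTrace (pre ++ e :: post)) : ¬ Joined pre e.tid := by
  rintro ⟨j, hj, hjo, hjt⟩
  exact hjt (hσ.join_last e.tid j e ((mem_iff_before hσ.nodup).1 hj) hjo (Or.inl rfl)).2.symm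

/-- A thread that is joined again is known to the joining thread. -/
theorem join_again {pre post : List (Event T L V)} {e : Event T L V}
    (hσ : IsTrace (pre ++ e :: post)) {u : T} (he : e.op = Op.join u) (hu : Joined pre u) :
    ∃ j ∈ pre, j.op = Op.join u ∧ j.tid = e.tid ∧
      ∀ a, Known (pre ++ e :: post) pre u a → Known (pre ++ e :: post) pre e.tid a := by
  have hn := hσ.nodup
  obtain ⟨j, hj, hjo, -⟩ := hu
  have hje := (mem_iff_before hn).1 hj
  have hjt := (hσ.join_last u j e hje hjo (Or.inr (Or.inr he))).2
  refine ⟨j, hj, hjo, hjt.symm, ?_⟩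
  rintro a ⟨p, hp, hpu, hap⟩
  rcases before_trichotomy hn hje.mem_left ((mem_iff_before hn).1 hp).mem_left with h | rfl | h
  · exact ⟨p, hp, Or.inl ((hσ.join_last u j p h hjo hpu).2.trans hjt.symm), hap⟩
  · exact ⟨j, hp, Or.inl hjt.symm, hap⟩
  · exact ⟨j, hj, Or.inl hjt.symm,
      hap.trans (shb_of_common_thread h hpu (Or.inr (Or.inr hjo)))⟩

namespace ClockInv

variable {pre post : List (Event T L V)} {e : Event T L V}

/-- Imported clocks lag behind in the component of the acting thread (for a self-join they agree),
so imports leave its own entry unchanged. -/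
theorem stamp_tid (I : ClockInv (pre ++ e :: post) pre) (hσ : IsTrace (pre ++ e :: post)) :
    stamp (runVC pre) e e.tid = (runVC pre).C e.tid e.tid := by
  have hj := not_joined_tid hσ
  cases ho : e.op <;> simp only [stamp, ho, Pi.sup_apply, sup_eq_left]
  · exact (I.lt_LW _ _ hj).le
  · exact (I.lt_Lk _ _ hj).le
  · rename_i u
    by_cases hu : u = e.tid
    · rw [hu]
    · exact (I.lt_C _ _ hj hu).le

theorem stamp_lt (I : ClockInv (pre ++ e :: post) pre) {r : T} (hr : r ≠ e.tid)
    (hj : ¬ Joined (pre ++ [e]) r) :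
    stamp (runVC pre) e r < (runVC pre).C r r := by
  have hj' : ¬ Joined pre r := fun ⟨j, h, h'⟩ => hj ⟨j, by simp [h], h'⟩
  have ht := I.lt_C _ _ hj' (Ne.symm hr)
  cases ho : e.op <;> simp only [stamp, ho, Pi.sup_apply, sup_lt_iff, ht, true_and]
  · exact I.lt_LW _ _ hj'
  · exact I.lt_Lk _ _ hj'
  · refine I.lt_C _ _ hj' ?_
    rintro rfl
    exact hj ⟨e, by simp, ho, hr.symm⟩

/-- The central vector clock property. The sources joined into the stamp correspond to the kinds of
edges entering `e` listed in `schedHB_iff`. -/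
theorem le_stamp_iff (I : ClockInv (pre ++ e :: post) pre) (hσ : IsTrace (pre ++ e :: post))
    {a : Event T L V} (ha : a ∈ pre ++ [e]) :
    localTime (pre ++ e :: post) a ≤ stamp (runVC pre) e a.tid ↔
      SchedHB (pre ++ e :: post) a e := by
  have hn := hσ.nodup
  rcases List.mem_append.1 ha with ha | ha
  · have ht := I.mem_C _ (not_joined_tid hσ) a ha
    rw [schedHB_iff hσ ha]
    cases ho : e.op <;>
      simp only [stamp, ho, Pi.sup_apply, le_sup_iff, ht, Event.OfThread, reduceCtorEq, or_false,
        false_and, exists_false, exists_eq_left', Op.read.injEq, Op.acq.injEq, Op.fork.injEq,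
        Op.join.injEq, false_or]
    · rw [I.mem_LW _ a ha]
    · rw [I.mem_Lk _ a ha]
    · rename_i u
      constructor
      · exact fun h => ⟨_, Or.inl rfl, h⟩
      · rintro ⟨t, rfl | rfl, h⟩
        · exact h
        · obtain ⟨p, hp, hpt, -⟩ := h
          exact absurd hpt (hσ.fork_first u p e ((mem_iff_before hn).1 hp) ho)
    · rename_i u
      -- `mem_C` is unavailable for a thread already joined by another. A repeated join imports
      -- nothing new, though: by `join_le` the clock of `u` is already below that of the joining
      -- thread.
      have key : localTime (pre ++ e :: post) a ≤ (runVC pre).C u a.tid →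
          Known (pre ++ e :: post) pre e.tid a ∨ Known (pre ++ e :: post) pre u a := fun h => by
        by_cases hu : Joined pre u
        · obtain ⟨j, hj, hjo, hjt, -⟩ := join_again hσ ho hu
          have := I.join_le j hj u hjo a.tid
          rw [hjt] at this
          exact Or.inl (ht.1 (h.trans this))
        · exact Or.inr ((I.mem_C _ hu a ha).1 h)
      constructor
      · rintro (h | h)
        · exact ⟨_, Or.inl rfl, h⟩
        · exact (key h).elim (fun h => ⟨_, Or.inl rfl, h⟩) (fun h => ⟨_, Or.inr rfl, h⟩)
      · rintro ⟨t, rfl | rfl, h⟩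
        · exact Or.inl h
        · by_cases hu : Joined pre u
          · obtain ⟨-, -, -, -, hk⟩ := join_again hσ ho hu
            exact Or.inl (hk a h)
          · exact Or.inr ((I.mem_C _ hu a ha).2 h)
  · rw [List.mem_singleton.1 ha, localTime_eq hn, I.stamp_tid hσ]
    exact iff_of_true le_rfl .refl

theorem fork_fresh (I : ClockInv (pre ++ e :: post) pre) (hσ : IsTrace (pre ++ e :: post))
    (u : T) (hu : e.op = Op.fork u) : (runVC pre).C u u = 1 :=
  I.C_fresh u fun a ha => hσ.fork_first u a e ((mem_iff_before hσ.nodup).1 ha) hu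

theorem stamp_tid_le (I : ClockInv (pre ++ e :: post) pre) (hσ : IsTrace (pre ++ e :: post)) :
    stamp (runVC pre) e e.tid ≤ ((runVC pre).step e).C e.tid e.tid := by
  rcases step_C_tid_tid (I.fork_fresh hσ) with h | h <;> omega

theorem self_le (I : ClockInv (pre ++ e :: post) pre) (hσ : IsTrace (pre ++ e :: post)) (r : T) :
    (runVC pre).C r r ≤ ((runVC pre).step e).C r r := by
  by_cases hr : r = e.tid
  · subst hr
    exact (I.stamp_tid hσ).symm.le.trans (I.stamp_tid_le hσ)
  · by_cases hf : e.op = Op.fork r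
    · rw [step_C_fork hr hf, I.fork_fresh hσ r hf]
      simp
    · rw [step_C_of_ne hr hf]

/-- The three kinds of events whose stamp is copied elsewhere are followed by a tick; it gives
strictness in the component of the acting thread. -/
theorem stamp_lt_step (I : ClockInv (pre ++ e :: post) pre) (hσ : IsTrace (pre ++ e :: post))
    (h : (∃ l, e.op = Op.rel l) ∨ (∃ x, e.op = Op.write x) ∨ ∃ u, e.op = Op.fork u) {r : T}
    (hj : ¬ Joined (pre ++ [e]) r) :
    stamp (runVC pre) e r < ((runVC pre).step e).C r r := by
  by_cases hr : r = e.tid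
  · subst hr
    rw [step_C_tid_tid_of_tick (I.fork_fresh hσ) h]
    omega
  · exact (I.stamp_lt hr hj).trans_le (I.self_le hσ r)

theorem le_step_tid (I : ClockInv (pre ++ e :: post) pre) (hσ : IsTrace (pre ++ e :: post)) :
    stamp (runVC pre) e ≤ ((runVC pre).step e).C e.tid := by
  intro r
  by_cases hr : r = e.tid
  · subst hr
    exact I.stamp_tid_le hσ
  · rw [step_C_tid_of_ne hr]

theorem localTime_self_not_le (hσ : IsTrace (pre ++ e :: post)) {c : VTime T}
    (hc : c e.tid < (runVC pre).C e.tid e.tid) :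
    ¬ localTime (pre ++ e :: post) e ≤ c e.tid := by
  rw [localTime_eq hσ.nodup]
  exact not_le.2 hc

end ClockInv

/-! ### Preservation of the invariant -/

theorem known_concat_iff {pre post : List (Event T L V)} {e a : Event T L V} {r : T}
    (hr : ¬ e.OfThread r) :
    Known (pre ++ e :: post) (pre ++ [e]) r a ↔ Known (pre ++ e :: post) pre r a := by
  constructor
  · rintro ⟨p, hp, hpr, h⟩
    rcases List.mem_append.1 hp with hp | hp
    · exact ⟨p, hp, hpr, h⟩
    · exact absurd (List.mem_singleton.1 hp ▸ hpr) hr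
  · rintro ⟨p, hp, h⟩
    exact ⟨p, by simp [hp], h⟩

theorem known_concat_iff_schedHB {pre post : List (Event T L V)} {e a : Event T L V} {r : T}
    (hσ : IsTrace (pre ++ e :: post)) (hr : e.OfThread r) :
    Known (pre ++ e :: post) (pre ++ [e]) r a ↔ SchedHB (pre ++ e :: post) a e := by
  constructor
  · rintro ⟨p, hp, hpr, h⟩
    rcases List.mem_append.1 hp with hp | hp
    · exact h.trans (shb_of_common_thread ((mem_iff_before hσ.nodup).1 hp) hpr hr)
    · exact List.mem_singleton.1 hp ▸ h
  · exact fun h => ⟨e, by simp, hr, h⟩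

theorem released_concat_iff {pre post : List (Event T L V)} {e a : Event T L V} {l : L}
    (hl : e.op ≠ Op.rel l) :
    Released (pre ++ e :: post) (pre ++ [e]) l a ↔ Released (pre ++ e :: post) pre l a := by
  constructor
  · rintro ⟨p, hp, hpl, h⟩
    rcases List.mem_append.1 hp with hp | hp
    · exact ⟨p, hp, hpl, h⟩
    · exact absurd (List.mem_singleton.1 hp ▸ hpl) hl
  · rintro ⟨p, hp, h⟩
    exact ⟨p, by simp [hp], h⟩

/-- Earlier releases of `l` lie below `e`, so overwriting the lock clock forgets nothing. -/
theorem released_concat_iff_schedHB {pre post : List (Event T L V)} {e a : Event T L V} {l : L}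
    (hσ : IsTrace (pre ++ e :: post)) (hl : e.op = Op.rel l) :
    Released (pre ++ e :: post) (pre ++ [e]) l a ↔ SchedHB (pre ++ e :: post) a e := by
  constructor
  · rintro ⟨p, hp, hpl, h⟩
    rcases List.mem_append.1 hp with hp | hp
    · exact h.trans (shb_of_common_lock hσ ((mem_iff_before hσ.nodup).1 hp) (Or.inr hpl)
        (Or.inr hl))
    · exact List.mem_singleton.1 hp ▸ h
  · exact fun h => ⟨e, by simp, hl, h⟩

theorem written_concat_iff {pre post : List (Event T L V)} {e a : Event T L V} {x : V}
    (hx : e.op ≠ Op.write x) :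
    Written (pre ++ e :: post) (pre ++ [e]) x a ↔ Written (pre ++ e :: post) pre x a := by
  have hmem : ∀ p : Event T L V, p.op = Op.write x → (p ∈ pre ++ [e] ↔ p ∈ pre) := by
    intro p hp
    have : p ≠ e := by rintro rfl; exact hx hp
    simp [this]
  constructor
  · rintro ⟨p, hp, hpx, hm, h⟩
    exact ⟨p, (hmem p hpx).1 hp, hpx, fun q hq hqx => hm q ((hmem q hqx).2 hq) hqx, h⟩
  · rintro ⟨p, hp, hpx, hm, h⟩
    exact ⟨p, (hmem p hpx).2 hp, hpx, fun q hq hqx => hm q ((hmem q hqx).1 hq) hqx, h⟩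

/-- Unlike releases of one lock, writes to `x` need not be comparable. Overwriting is still right
because `Written` refers to the last write only. -/
theorem written_concat_iff_schedHB {pre post : List (Event T L V)} {e a : Event T L V} {x : V}
    (hσ : IsTrace (pre ++ e :: post)) (hx : e.op = Op.write x) :
    Written (pre ++ e :: post) (pre ++ [e]) x a ↔ SchedHB (pre ++ e :: post) a e := by
  have hn := hσ.nodup
  constructor
  · rintro ⟨p, hp, hpx, hm, h⟩
    rcases List.mem_append.1 hp with hp | hp
    · exact absurd ((mem_iff_before hn).1 hp) (hm e (by simp) hx)
    · exact List.mem_singleton.1 hp ▸ h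
  · refine fun h => ⟨e, by simp, hx, fun q hq _ heq => ?_, h⟩
    rcases List.mem_append.1 hq with hq | hq
    · exact heq.asymm hn ((mem_iff_before hn).1 hq)
    · exact heq.ne hn (List.mem_singleton.1 hq).symm

theorem not_schedHB_self {pre post : List (Event T L V)} {e p : Event T L V}
    (hn : (pre ++ e :: post).Nodup) (hp : p ∈ pre) : ¬ SchedHB (pre ++ e :: post) e p := fun h =>
  ((mem_iff_before hn).1 (mem_of_schedHB hn h hp)).ne hn rfl

namespace ClockInv

variable {pre post : List (Event T L V)} {e : Event T L V}

theorem concat_C (I : ClockInv (pre ++ e :: post) pre) (hσ : IsTrace (pre ++ e :: post))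
    {r : T} (hj : ¬ Joined (pre ++ [e]) r) {a : Event T L V} (ha : a ∈ pre ++ [e]) :
    localTime (pre ++ e :: post) a ≤ ((runVC pre).step e).C r a.tid ↔
      Known (pre ++ e :: post) (pre ++ [e]) r a := by
  have hn := hσ.nodup
  have hj' : ¬ Joined pre r := fun ⟨j, h, h'⟩ => hj ⟨j, by simp [h], h'⟩
  have hs := I.le_stamp_iff hσ ha
  by_cases he : e.OfThread r
  · rw [known_concat_iff_schedHB hσ he, ← hs]
    by_cases hr : r = e.tid
    · subst hr
      by_cases hat : a.tid = e.tid
      · have h : localTime (pre ++ e :: post) a ≤ stamp (runVC pre) e a.tid := by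
          rw [hs]
          rcases List.mem_append.1 ha with ha | ha
          · exact shb_of_common_thread ((mem_iff_before hn).1 ha) (Or.inl hat) (Or.inl rfl)
          · rw [List.mem_singleton.1 ha]
        exact iff_of_true (h.trans (I.le_step_tid hσ _)) h
      · rw [step_C_tid_of_ne hat]
    · rcases he with he | he | he
      · exact absurd he.symm hr
      -- No event of a thread precedes its fork, so the entry reset to 1 by the fork is never
      -- consulted.
      · have hat : a.tid ≠ r := by
          intro hat
          rcases List.mem_append.1 ha with ha | ha
          · exact hσ.fork_first r a e ((mem_iff_before hn).1 ha) he (Or.inl hat)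
          · exact hr (hat.symm.trans (by rw [List.mem_singleton.1 ha]))
        rw [step_C_fork hr he, Function.update_of_ne hat]
      · exact absurd ⟨e, by simp, he, Ne.symm hr⟩ hj
  · have hr : r ≠ e.tid := fun h => he (Or.inl h.symm)
    rw [known_concat_iff he, step_C_of_ne hr fun h => he (Or.inr (Or.inl h))]
    rcases List.mem_append.1 ha with ha | ha
    · exact I.mem_C r hj' a ha
    · rw [List.mem_singleton.1 ha]
      -- For the new event itself: the clock of an uninvolved thread is strictly behind in the entry
      -- of `e.tid`.
      refine iff_of_false (localTime_self_not_le hσ (I.lt_C _ _ (not_joined_tid hσ) hr)) ?_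
      rintro ⟨p, hp, -, h⟩
      exact not_schedHB_self hn hp h

theorem concat_lt_C (I : ClockInv (pre ++ e :: post) pre) (hσ : IsTrace (pre ++ e :: post))
    {t r : T} (hj : ¬ Joined (pre ++ [e]) r) (htr : t ≠ r) :
    ((runVC pre).step e).C t r < ((runVC pre).step e).C r r := by
  have hj' : ¬ Joined pre r := fun ⟨j, h, h'⟩ => hj ⟨j, by simp [h], h'⟩
  by_cases ht : t = e.tid
  · subst ht
    rw [step_C_tid_of_ne (Ne.symm htr)]
    exact (I.stamp_lt (Ne.symm htr) hj).trans_le (I.self_le hσ r)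
  · by_cases hf : e.op = Op.fork t
    · rw [step_C_fork ht hf, Function.update_of_ne (Ne.symm htr)]
      exact I.stamp_lt_step hσ (Or.inr (Or.inr ⟨t, hf⟩)) hj
    · rw [step_C_of_ne ht hf]
      exact (I.lt_C t r hj' htr).trans_le (I.self_le hσ r)

theorem concat_join_le (I : ClockInv (pre ++ e :: post) pre) (hσ : IsTrace (pre ++ e :: post))
    {j : Event T L V} (hj : j ∈ pre ++ [e]) {u : T} (hu : j.op = Op.join u) :
    ((runVC pre).step e).C u ≤ ((runVC pre).step e).C j.tid := by
  have hn := hσ.nodup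
  by_cases hju : j.tid = u
  · rw [hju]
  rcases List.mem_append.1 hj with hj | hj
  · have hb := (mem_iff_before hn).1 hj
    -- A thread joined by another is frozen: it can neither act nor be forked afterwards.
    have hold : ((runVC pre).step e).C u = (runVC pre).C u := by
      refine step_C_of_ne (fun h => hju ?_) (fun h => ?_)
      · exact (hσ.join_last u j e hb hu (Or.inl h.symm)).2.symm.trans h.symm
      · have := (hσ.join_last u j e hb hu (Or.inr (Or.inl h))).1
        simp [h] at this
    rw [hold]
    refine (I.join_le j hj u hu).trans ?_
    by_cases ht : j.tid = e.tid
    · rw [ht]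
      refine le_trans ?_ (I.le_step_tid hσ)
      unfold stamp
      split <;> simp
    · rw [step_C_of_ne ht fun h => hσ.fork_first j.tid j e hb h (Or.inl rfl)]
  · rw [List.mem_singleton.1 hj] at hu hju ⊢
    rw [step_C_of_ne (Ne.symm hju) (by simp [hu])]
    refine le_trans ?_ (I.le_step_tid hσ)
    simp [stamp, hu]

theorem le_stamp_of_tid_eq (I : ClockInv (pre ++ e :: post) pre)
    (hσ : IsTrace (pre ++ e :: post)) {a : Event T L V} (ha : a ∈ pre ++ [e])
    (hat : a.tid = e.tid) : localTime (pre ++ e :: post) a ≤ stamp (runVC pre) e a.tid := by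
  rw [I.le_stamp_iff hσ ha]
  rcases List.mem_append.1 ha with ha | ha
  · exact shb_of_common_thread ((mem_iff_before hσ.nodup).1 ha) (Or.inl hat) (Or.inl rfl)
  · rw [List.mem_singleton.1 ha]

theorem concat (I : ClockInv (pre ++ e :: post) pre) (hσ : IsTrace (pre ++ e :: post)) :
    ClockInv (pre ++ e :: post) (pre ++ [e]) := by
  have hn := hσ.nodup
  have hmono : ∀ r, ¬ Joined (pre ++ [e]) r → ¬ Joined pre r :=
    fun r hj ⟨j, h, h'⟩ => hj ⟨j, by simp [h], h'⟩
  have hself := localTime_eq hn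
  have hstamp := I.stamp_tid hσ
  constructor <;> simp only [runVC_concat]
  · exact fun t r hj htr => I.concat_lt_C hσ hj htr
  · intro l r hj
    rw [step_Lk]
    split_ifs with h
    · exact I.stamp_lt_step hσ (Or.inl ⟨l, h⟩) hj
    · exact (I.lt_Lk l r (hmono r hj)).trans_le (I.self_le hσ r)
  · intro x r hj
    rw [step_LW]
    split_ifs with h
    · exact I.stamp_lt_step hσ (Or.inr (Or.inl ⟨x, h⟩)) hj
    · exact (I.lt_LW x r (hmono r hj)).trans_le (I.self_le hσ r)
  · intro u hu
    have he := hu e (by simp)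
    rw [step_C_of_ne (fun h => he (Or.inl h.symm)) fun h => he (Or.inr (Or.inl h))]
    exact I.C_fresh u fun a ha => hu a (by simp [ha])
  · exact fun r hj a ha => I.concat_C hσ hj ha
  · intro l a ha
    rw [step_Lk]
    split_ifs with h
    · rw [released_concat_iff_schedHB hσ h, I.le_stamp_iff hσ ha]
    · rw [released_concat_iff h]
      rcases List.mem_append.1 ha with ha | ha
      · exact I.mem_Lk l a ha
      · rw [List.mem_singleton.1 ha]
        refine iff_of_false (localTime_self_not_le hσ (I.lt_Lk _ _ (not_joined_tid hσ))) ?_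
        rintro ⟨p, hp, -, h⟩
        exact not_schedHB_self hn hp h
  · intro x a ha
    rw [step_LW]
    split_ifs with h
    · rw [written_concat_iff_schedHB hσ h, I.le_stamp_iff hσ ha]
    · rw [written_concat_iff h]
      rcases List.mem_append.1 ha with ha | ha
      · exact I.mem_LW x a ha
      · rw [List.mem_singleton.1 ha]
        refine iff_of_false (localTime_self_not_le hσ (I.lt_LW _ _ (not_joined_tid hσ))) ?_
        rintro ⟨p, hp, -, -, h⟩
        exact not_schedHB_self hn hp h
  · exact fun j hj u hu => I.concat_join_le hσ hj hu
  · intro x a ha hax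
    rw [step_R]
    split_ifs with h
    · exact I.le_stamp_of_tid_eq hσ ha h.2.symm
    · rcases List.mem_append.1 ha with ha | ha
      · exact I.le_R x a ha hax
      · rw [List.mem_singleton.1 ha] at h hax
        exact absurd ⟨hax, rfl⟩ h
  · intro x r
    rw [step_R]
    split_ifs with h
    · refine Or.inr ⟨e, by simp, h.1, h.2, ?_⟩
      rw [← h.2, hstamp, hself]
    · refine (I.R_eq x r).imp_right ?_
      rintro ⟨a, ha, h⟩
      exact ⟨a, by simp [ha], h⟩
  · intro x a ha hax
    rw [step_W]
    split_ifs with h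
    · exact I.le_stamp_of_tid_eq hσ ha h.2.symm
    · rcases List.mem_append.1 ha with ha | ha
      · exact I.le_W x a ha hax
      · rw [List.mem_singleton.1 ha] at h hax
        exact absurd ⟨hax, rfl⟩ h
  · intro x r
    rw [step_W]
    split_ifs with h
    · refine Or.inr ⟨e, by simp, h.1, h.2, ?_⟩
      rw [← h.2, hstamp, hself]
    · refine (I.W_eq x r).imp_right ?_
      rintro ⟨a, ha, h⟩
      exact ⟨a, by simp [ha], h⟩

end ClockInv

theorem clockInv_of_prefix {σ : List (Event T L V)} (hσ : IsTrace σ) :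
    ∀ pre post : List (Event T L V), σ = pre ++ post → ClockInv σ pre := by
  intro pre
  induction pre using List.reverseRecOn with
  | nil => exact fun _ _ => clockInv_nil σ
  | append_singleton pre e ih =>
    intro post h
    rw [List.append_assoc, List.singleton_append] at h
    have I := ih _ h
    subst h
    exact I.concat hσ

/-! ### The race checks -/

/-- Each nonzero entry of `c` is the local time of an actual access, so a failing entry yields an
unknown one; conversely `c` dominates every access, so an unknown one makes its entry fail. Accesses
by `t` itself are always known. -/
theorem exists_not_le_iff {σ pre : List (Event T L V)} (I : ClockInv σ pre) {t : T}
    (ht : ¬ Joined pre t) {c : VTime T} {o : Op T L V}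
    (hle : ∀ a ∈ pre, a.op = o → localTime σ a ≤ c a.tid)
    (heq : ∀ r, c r = 0 ∨ ∃ a ∈ pre, a.op = o ∧ a.tid = r ∧ c r = localTime σ a) :
    ¬ c ≤ (runVC pre).C t ↔ ∃ a ∈ pre, a.op = o ∧ a.tid ≠ t ∧ ¬ Known σ pre t a := by
  rw [Pi.le_def, not_forall]
  constructor
  · rintro ⟨r, hr⟩
    rcases heq r with h | ⟨a, ha, hao, rfl, h⟩
    · simp [h] at hr
    · rw [h, I.mem_C t ht a ha] at hr
      exact ⟨a, ha, hao, fun hat => hr ⟨a, ha, Or.inl hat, .refl⟩, hr⟩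
  · rintro ⟨a, ha, hao, -, hk⟩
    exact ⟨a.tid, fun h => hk ((I.mem_C t ht a ha).1 ((hle a ha hao).trans h))⟩

theorem declaresRace_iff {pre post : List (Event T L V)} {e : Event T L V}
    (hσ : IsTrace (pre ++ e :: post)) :
    (runVC pre).DeclaresRace e ↔
      ∃ a, Before (pre ++ e :: post) a e ∧ Conflicting a e ∧
        ¬ KnownBefore (pre ++ e :: post) a e := by
  have hn := hσ.nodup
  have I := clockInv_of_prefix hσ pre (e :: post) rfl
  have ht := not_joined_tid hσ
  have hk : ∀ a, KnownBefore (pre ++ e :: post) a e ↔ Known (pre ++ e :: post) pre e.tid a := by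
    simp [KnownBefore, Known, mem_iff_before hn]
  have hW := fun x => exists_not_le_iff I ht (I.le_W x) (I.W_eq x)
  have hR := fun x => exists_not_le_iff I ht (I.le_R x) (I.R_eq x)
  simp only [hk, ← mem_iff_before hn, Conflicting]
  cases ho : e.op with
  | read x =>
    simp only [VCState.DeclaresRace, ho, hW]
    constructor
    · rintro ⟨a, ha, hax, hat, h⟩
      exact ⟨a, ha, ⟨hat, x, by simp [hax]⟩, h⟩
    · rintro ⟨a, ha, ⟨hat, y, hy⟩, h⟩
      simp only [reduceCtorEq, and_false, false_or, or_false, Op.read.injEq] at hy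
      exact ⟨a, ha, hy.2 ▸ hy.1, hat, h⟩
  | write x =>
    simp only [VCState.DeclaresRace, ho, hW, hR]
    constructor
    · rintro (⟨a, ha, hax, hat, h⟩ | ⟨a, ha, hax, hat, h⟩) <;>
        exact ⟨a, ha, ⟨hat, x, by simp [hax]⟩, h⟩
    · rintro ⟨a, ha, ⟨hat, y, hy⟩, h⟩
      simp only [reduceCtorEq, and_false, false_or, Op.write.injEq] at hy
      rcases hy with ⟨hy, rfl⟩ | ⟨hy, rfl⟩
      · exact Or.inr ⟨a, ha, hy, hat, h⟩
      · exact Or.inl ⟨a, ha, hy, hat, h⟩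
  | _ => simp [VCState.DeclaresRace, ho]

end SHB

theorem mainTheorem3 {T L V : Type*} [DecidableEq T] [DecidableEq L] [DecidableEq V]
    (σ : List (SHB.Event T L V)) (hσ : SHB.IsTrace σ)
    (e : SHB.Event T L V) (he : e ∈ σ) (hacc : e.IsAccess) :
    SHB.ReportsRaceAt σ e ↔ ∃ e' ∈ σ, SHB.HBSchedulableRace σ e' e := by
  simp only [SHB.hbSchedulableRace_iff hσ]
  constructor
  · rintro ⟨pre, post, rfl, h⟩
    obtain ⟨a, ha, h⟩ := (SHB.declaresRace_iff hσ).1 h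
    exact ⟨a, ha.mem_left, ha, h⟩
  · rintro ⟨a, -, h⟩
    obtain ⟨pre, post, rfl⟩ := List.append_of_mem he
    exact ⟨pre, post, rfl, (SHB.declaresRace_iff hσ).2 ⟨a, h⟩⟩
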